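/- Let $n\ge 1$, let $S^n=\{x\in\mathbb{R}^{n+1}:\langle x,x\rangle=1\}$ be the unit sphere with geodesic distance $d(x,y)=\arccos\langle x,y\rangle$ and $n$-dimensional volume (surface measure) $V$, let $B(z,r)=\{x\in S^n: d(x,z)\le r\}$ for $z\in S^n$ and $r>0$, and let $\operatorname{diam}X=\sup\{d(x,y):x,y\in X\}$ for $X\subset S^n$ (with $\operatorname{diam}\emptyset=0$). Fix $z_0\in S^n$. If $D\in(0,\pi)$ and $X\subset S^n$ is (Lebesgue) measurable with $\operatorname{diam}X\le D$, then $$V(X)\le V(B(z_0,D/2)),$$ and equality holds if and only if the closure $\overline{X}$ of $X$ is a ball of radius $D/2$, that is, $\overline{X}=B(z,D/2)$ for some $z\in S^n$, and $V(\overline{X}\setminus X)=0$. -/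

import Mathlib

open MeasureTheory

/-- The unit sphere `Sⁿ = {x ∈ ℝⁿ⁺¹ : ⟨x, x⟩ = 1}`, with the subspace topology and its Borel
σ-algebra. -/
abbrev UnitSphere (n : ℕ) : Type :=
  Metric.sphere (0 : EuclideanSpace ℝ (Fin (n + 1))) 1

namespace UnitSphere

/-- The geodesic distance on `Sⁿ`: the angle `arccos ⟨x, y⟩ ∈ [0, π]` between unit vectors. -/
noncomputable def geodesicDist {n : ℕ} (x y : UnitSphere n) : ℝ :=
  InnerProductGeometry.angle (x : EuclideanSpace ℝ (Fin (n + 1))) y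

/-- The geodesic diameter `sup {d(x, y) : x, y ∈ X}`. The distances are bounded by `π`, so the
supremum is a genuine one unless `X` is empty, in which case it is `0`. -/
noncomputable def geodesicDiam {n : ℕ} (X : Set (UnitSphere n)) : ℝ :=
  sSup (Set.image2 geodesicDist X X)

/-- The closed geodesic ball `B(z, r) = {x ∈ Sⁿ : d(x, z) ≤ r}`. -/
def geodesicBall {n : ℕ} (z : UnitSphere n) (r : ℝ) : Set (UnitSphere n) :=
  {x | geodesicDist x z ≤ r}

/-- The `n`-dimensional volume on `Sⁿ`: the surface measure induced by Lebesgue measure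
on `ℝⁿ⁺¹`. -/
noncomputable def vol (n : ℕ) : Measure (UnitSphere n) :=
  (volume : Measure (EuclideanSpace ℝ (Fin (n + 1)))).toSphere

end UnitSphere

namespace UnitSphere

open Set Filter Topology Real
open scoped RealInnerProductSpace ENNReal

variable {n : ℕ}

/-! ### The geodesic distance -/

/-! One rigidity statement yields both claims: a nonempty closed set `X` of diameter at most `D`
with at least the volume of a ball of radius `D / 2` is such a ball
(`IsIsodiametric.exists_eq_geodesicBall`). It is applied to the closure of the given set.

The isoperimetric inequality comes from two-point symmetrization, which keeps volume and does not
increase the volume of neighbourhoods. Among compact sets at least as large as a ball `B` whose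
`t`-neighbourhood is no larger than that of `Y`, one with maximal overlap with `B` contains `B`;
otherwise some reflection would increase the overlap.

For extremal `X`, the `s`-neighbourhood of `X` and the antipodal image of its `(π - D -
s)`-neighbourhood are disjoint by the diameter bound, while isoperimetry makes their volumes add up
to the whole sphere. No nonempty open set avoids both, so a point `p` at distance `t` from `X` has
some `y ∈ X` with `d(p, y) ≥ D + t`. For a nearest point `x` the triangle `p, x, y` degenerates, so
`x` is unique. Symmetrization preserves extremality, and uniqueness for the symmetrized set shows
that the reflection exchanging two such points `p, q` carries the nearest point `f p` to `f q`.
Hence `f q - f p` is parallel to `q - p`, which forces `f p = l p + a` with constant `l` and `a`,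
and `⟨a, p⟩ = cos t - l`: the points at distance `t` lie in a hyperplane. The `t`-neighbourhood is
then a cap up to its boundary, which puts `X` inside a ball of radius `D / 2`; volume forces
equality. -/

lemma inner_self_coe (x : UnitSphere n) :
    ⟪(x : EuclideanSpace ℝ (Fin (n + 1))), (x : EuclideanSpace ℝ (Fin (n + 1)))⟫ = 1 := by
  rw [real_inner_self_eq_norm_sq, norm_eq_of_mem_sphere, one_pow]

lemma cos_geodesicDist (x y : UnitSphere n) :
    cos (geodesicDist x y) = ⟪(x : EuclideanSpace ℝ (Fin (n + 1))), y⟫ :=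
  (InnerProductGeometry.inner_eq_cos_angle_of_norm_eq_one (norm_eq_of_mem_sphere x)
    (norm_eq_of_mem_sphere y)).symm

lemma geodesicDist_eq_arccos (x y : UnitSphere n) :
    geodesicDist x y = arccos ⟪(x : EuclideanSpace ℝ (Fin (n + 1))), y⟫ := by
  simp [geodesicDist, InnerProductGeometry.angle]

lemma geodesicDist_nonneg (x y : UnitSphere n) : 0 ≤ geodesicDist x y :=
  InnerProductGeometry.angle_nonneg _ _

lemma geodesicDist_le_pi (x y : UnitSphere n) : geodesicDist x y ≤ π :=
  InnerProductGeometry.angle_le_pi _ _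

lemma geodesicDist_comm (x y : UnitSphere n) : geodesicDist x y = geodesicDist y x :=
  InnerProductGeometry.angle_comm _ _

lemma geodesicDist_triangle (x y z : UnitSphere n) :
    geodesicDist x z ≤ geodesicDist x y + geodesicDist y z :=
  InnerProductGeometry.angle_le_angle_add_angle _ _ _

@[simp]
lemma geodesicDist_self (x : UnitSphere n) : geodesicDist x x = 0 :=
  InnerProductGeometry.angle_self (ne_zero_of_mem_unit_sphere x)

lemma geodesicDist_neg_right (x y : UnitSphere n) : geodesicDist x (-y) = π - geodesicDist x y :=
  InnerProductGeometry.angle_neg_right _ _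

lemma eq_of_geodesicDist_eq_zero {x y : UnitSphere n} (h : geodesicDist x y = 0) : x = y :=
  Subtype.ext (InnerProductGeometry.eq_of_angle_eq_zero_of_norm_eq h
    (by rw [norm_eq_of_mem_sphere, norm_eq_of_mem_sphere]))

lemma geodesicDist_le_geodesicDist_iff {x y x' y' : UnitSphere n} :
    geodesicDist x y ≤ geodesicDist x' y' ↔
      ⟪(x' : EuclideanSpace ℝ (Fin (n + 1))), y'⟫ ≤ ⟪(x : EuclideanSpace ℝ (Fin (n + 1))), y⟫ := by
  rw [← cos_geodesicDist, ← cos_geodesicDist]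
  exact (strictAntiOn_cos.le_iff_ge ⟨geodesicDist_nonneg _ _, geodesicDist_le_pi _ _⟩
    ⟨geodesicDist_nonneg _ _, geodesicDist_le_pi _ _⟩).symm

lemma continuous_geodesicDist :
    Continuous fun p : UnitSphere n × UnitSphere n ↦ geodesicDist p.1 p.2 := by
  simp only [geodesicDist_eq_arccos]
  fun_prop

lemma continuous_geodesicDist_left (z : UnitSphere n) : Continuous fun x ↦ geodesicDist x z := by
  simp only [geodesicDist_eq_arccos]
  fun_prop

lemma continuous_geodesicDist_right (z : UnitSphere n) : Continuous fun x ↦ geodesicDist z x := by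
  simp only [geodesicDist_eq_arccos]
  fun_prop

/-- The squared chord is `2 - 2 cos θ`, and `cos θ ≤ 1 - 2θ²/π²` on `[0, π]`. This transfers
closeness in the chordal Hausdorff metric to geodesic neighbourhoods. -/
lemma geodesicDist_le_dist (x y : UnitSphere n) : geodesicDist x y ≤ π / 2 * dist x y := by
  have h0 := geodesicDist_nonneg x y
  have h : cos (geodesicDist x y) ≤ 1 - 2 / π ^ 2 * geodesicDist x y ^ 2 :=
    cos_le_one_sub_mul_cos_sq (by rw [abs_of_nonneg h0]; exact geodesicDist_le_pi x y)
  have hd : dist x y ^ 2 = 2 - 2 * cos (geodesicDist x y) := by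
    rw [Subtype.dist_eq, dist_eq_norm, norm_sub_sq_real, norm_eq_of_mem_sphere,
      norm_eq_of_mem_sphere, cos_geodesicDist]
    ring
  refine le_of_sq_le_sq ?_ (by positivity)
  have : geodesicDist x y ^ 2 = (π / 2) ^ 2 * (2 * (2 / π ^ 2 * geodesicDist x y ^ 2)) := by
    field_simp
  rw [mul_pow, hd, this]
  gcongr
  linarith

lemma isClosed_geodesicBall (z : UnitSphere n) (r : ℝ) : IsClosed (geodesicBall z r) :=
  isClosed_le (continuous_geodesicDist_left z) continuous_const

lemma isOpen_setOf_geodesicDist_lt (z : UnitSphere n) (r : ℝ) :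
    IsOpen {x | geodesicDist x z < r} :=
  isOpen_lt (continuous_geodesicDist_left z) continuous_const

/-! ### Great circles -/

/-- The point at angle `s` on the great circle through `z` with initial direction `u`. -/
noncomputable def greatCircle (z u : UnitSphere n)
    (h : ⟪(z : EuclideanSpace ℝ (Fin (n + 1))), u⟫ = 0) (s : ℝ) : UnitSphere n :=
  ⟨cos s • (z : EuclideanSpace ℝ (Fin (n + 1))) + sin s • (u : EuclideanSpace ℝ (Fin (n + 1))), by
    rw [mem_sphere_zero_iff_norm, ← sq_eq_sq₀ (norm_nonneg _) zero_le_one, norm_add_sq_real]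
    simp only [norm_smul, norm_eq_of_mem_sphere, real_inner_smul_left, real_inner_smul_right, h]
    simp⟩

section greatCircle

variable {z u : UnitSphere n} (h : ⟪(z : EuclideanSpace ℝ (Fin (n + 1))), u⟫ = 0)

lemma coe_greatCircle (s : ℝ) : (greatCircle z u h s : EuclideanSpace ℝ (Fin (n + 1))) =
    cos s • (z : EuclideanSpace ℝ (Fin (n + 1))) + sin s • (u : EuclideanSpace ℝ (Fin (n + 1))) :=
  rfl

@[simp]
lemma greatCircle_zero : greatCircle z u h 0 = z := by
  ext1; simp [coe_greatCircle]

lemma continuous_greatCircle : Continuous (greatCircle z u h) :=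
  Continuous.subtype_mk (by fun_prop) _

lemma geodesicDist_greatCircle {s t : ℝ} (hst : |s - t| ≤ π) :
    geodesicDist (greatCircle z u h s) (greatCircle z u h t) = |s - t| := by
  have h' : ⟪(u : EuclideanSpace ℝ (Fin (n + 1))), z⟫ = 0 := by rw [real_inner_comm, h]
  rw [geodesicDist_eq_arccos, coe_greatCircle, coe_greatCircle]
  simp only [inner_add_left, inner_add_right, real_inner_smul_left, real_inner_smul_right, h, h',
    inner_self_coe]
  rw [← arccos_cos (abs_nonneg _) hst, cos_abs, cos_sub]
  congr 1
  ring

lemma inner_greatCircle (s : ℝ) :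
    ⟪(z : EuclideanSpace ℝ (Fin (n + 1))), greatCircle z u h s⟫ = cos s := by
  simp [coe_greatCircle, inner_add_right, real_inner_smul_right, h]

end greatCircle

lemma exists_inner_eq_zero (hn : 1 ≤ n) (z : UnitSphere n) :
    ∃ u : UnitSphere n, ⟪(z : EuclideanSpace ℝ (Fin (n + 1))), u⟫ = 0 := by
  have hfin : 0 < Module.finrank ℝ (ℝ ∙ (z : EuclideanSpace ℝ (Fin (n + 1))))ᗮ := by
    have := (ℝ ∙ (z : EuclideanSpace ℝ (Fin (n + 1)))).finrank_add_finrank_orthogonal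
    rw [finrank_span_singleton (ne_zero_of_mem_unit_sphere z), finrank_euclideanSpace,
      Fintype.card_fin] at this
    omega
  have := Module.finrank_pos_iff.mp hfin
  obtain ⟨v, hv⟩ := exists_ne (0 : (ℝ ∙ (z : EuclideanSpace ℝ (Fin (n + 1))))ᗮ)
  have hv0 : (v : EuclideanSpace ℝ (Fin (n + 1))) ≠ 0 := by simpa using hv
  refine ⟨⟨‖(v : EuclideanSpace ℝ (Fin (n + 1)))‖⁻¹ • (v : EuclideanSpace ℝ (Fin (n + 1))), ?_⟩, ?_⟩
  · rw [mem_sphere_zero_iff_norm, norm_smul, norm_inv, norm_norm,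
      inv_mul_cancel₀ (norm_ne_zero_iff.mpr hv0)]
  · rw [real_inner_smul_right, Submodule.mem_orthogonal_singleton_iff_inner_right.mp v.2, mul_zero]

/-- Polar coordinates around `z`. -/
lemma exists_greatCircle_eq (hn : 1 ≤ n) (z x : UnitSphere n) :
    ∃ (u : UnitSphere n) (h : ⟪(z : EuclideanSpace ℝ (Fin (n + 1))), u⟫ = 0),
      greatCircle z u h (geodesicDist x z) = x := by
  set v : EuclideanSpace ℝ (Fin (n + 1)) := x - cos (geodesicDist x z) • z with hv
  have hc : ⟪(z : EuclideanSpace ℝ (Fin (n + 1))), x⟫ = cos (geodesicDist x z) := by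
    rw [cos_geodesicDist, real_inner_comm]
  have hzv : ⟪(z : EuclideanSpace ℝ (Fin (n + 1))), v⟫ = 0 := by
    rw [hv, inner_sub_right, real_inner_smul_right, inner_self_coe, hc]; ring
  have hnorm : ‖v‖ = sin (geodesicDist x z) := by
    rw [← sq_eq_sq₀ (norm_nonneg _) 
      (sin_nonneg_of_nonneg_of_le_pi (geodesicDist_nonneg _ _) (geodesicDist_le_pi _ _)), hv,
      norm_sub_sq_real, norm_smul, norm_eq_of_mem_sphere, norm_eq_of_mem_sphere,
      real_inner_smul_right, real_inner_comm, hc, sin_sq]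
    simp; ring
  by_cases h0 : v = 0
  -- Here `x = ± z`, the sine vanishes, and any direction serves.
  · obtain ⟨u, hu⟩ := exists_inner_eq_zero hn z
    refine ⟨u, hu, Subtype.ext ?_⟩
    rw [coe_greatCircle, ← hnorm, h0, norm_zero, zero_smul, add_zero]
    rw [← sub_eq_zero.mp (hv.symm.trans h0)]
  · have hs : sin (geodesicDist x z) ≠ 0 := by rw [← hnorm]; exact norm_ne_zero_iff.mpr h0
    refine ⟨⟨(sin (geodesicDist x z))⁻¹ • v, ?_⟩, ?_, Subtype.ext ?_⟩
    · rw [mem_sphere_zero_iff_norm, norm_smul, norm_inv, ← hnorm, norm_norm,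
        inv_mul_cancel₀ (norm_ne_zero_iff.mpr h0)]
    · rw [real_inner_smul_right, hzv, mul_zero]
    · rw [coe_greatCircle, smul_inv_smul₀ hs, hv]
      abel

/-- A point on a minimal geodesic at prescribed distances from the endpoints. -/
lemma exists_geodesicDist_eq (hn : 1 ≤ n) (x z : UnitSphere n) {s : ℝ} (hs : 0 ≤ s)
    (hs' : s ≤ geodesicDist x z) :
    ∃ m : UnitSphere n, geodesicDist m z = s ∧ geodesicDist x m = geodesicDist x z - s := by
  obtain ⟨u, h, hx⟩ := exists_greatCircle_eq hn z x
  have hpi := geodesicDist_le_pi x z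
  refine ⟨greatCircle z u h s, ?_, ?_⟩
  · have := geodesicDist_greatCircle h (s := s) (t := 0)
      (by rw [sub_zero, abs_of_nonneg hs]; linarith)
    rwa [greatCircle_zero, sub_zero, abs_of_nonneg hs] at this
  · have : |geodesicDist x z - s| = geodesicDist x z - s := abs_of_nonneg (by linarith)
    conv_lhs => rw [← hx]
    rw [geodesicDist_greatCircle h (by rw [this]; linarith), this]

/-- Equality in the triangle inequality along a nondegenerate geodesic determines the
intermediate point. -/
lemma eq_of_geodesicDist_eq_add {p x x' y : UnitSphere n} {s t : ℝ} (ht : 0 < s + t)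
    (hst : s + t < π) (hx : geodesicDist p x = t) (hx' : geodesicDist p x' = t)
    (hxy : geodesicDist x y = s) (hxy' : geodesicDist x' y = s)
    (hpy : geodesicDist p y = s + t) : x = x' := by
  have hθ : sin (s + t) ≠ 0 := (sin_pos_of_pos_of_lt_pi ht hst).ne'
  -- Spherical interpolation: the three distances fix all inner products, so the squared norm of the
  -- difference of the two sides can be computed.
  have key : ∀ x : UnitSphere n, geodesicDist p x = t → geodesicDist x y = s →
      sin (s + t) • (x : EuclideanSpace ℝ (Fin (n + 1))) = sin s • (p : EuclideanSpace ℝ (Fin (n + 1)))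
        + sin t • (y : EuclideanSpace ℝ (Fin (n + 1))) := by
    intro x hx hxy
    rw [← sub_eq_zero, ← norm_eq_zero, ← sq_eq_zero_iff, norm_sub_sq_real, norm_add_sq_real]
    simp only [norm_smul, norm_eq_of_mem_sphere, inner_add_right, real_inner_smul_left,
      real_inner_smul_right, mul_one, norm_eq_abs, sq_abs]
    rw [real_inner_comm, ← cos_geodesicDist, ← cos_geodesicDist, ← cos_geodesicDist, hx, hxy, hpy,
      sin_add, cos_add]
    linear_combination (-(sin s ^ 2)) * sin_sq_add_cos_sq t + (-(sin t ^ 2)) * sin_sq_add_cos_sq s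
  refine Subtype.ext (smul_right_injective _ hθ ?_)
  simp only [key x hx hxy, key x' hx' hxy']

/-! ### Isometries and reflections -/

/-- Surface measure is a multiple of the Lebesgue measure of the cone over a set, and the cone over
`f ⁻¹' s` is the `L`-preimage of the cone over `s`. -/
lemma measurePreserving_of_coe_eq
    (L : EuclideanSpace ℝ (Fin (n + 1)) ≃ₗᵢ[ℝ] EuclideanSpace ℝ (Fin (n + 1)))
    {f : UnitSphere n → UnitSphere n} (hf : ∀ x, (f x : EuclideanSpace ℝ (Fin (n + 1))) = L x) :
    MeasurePreserving f (vol n) (vol n) := by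
  have hc : Continuous f := by
    rw [continuous_induced_rng]
    rw [show ((↑) ∘ f : UnitSphere n → EuclideanSpace ℝ (Fin (n + 1))) = L ∘ (↑) from funext hf]
    exact L.continuous.comp continuous_subtype_val
  refine ⟨hc.measurable, Measure.ext fun s hs ↦ ?_⟩
  rw [Measure.map_apply hc.measurable hs, vol, Measure.toSphere_apply' _ (hc.measurable hs),
    Measure.toSphere_apply' _ hs]
  congr 1
  refine Eq.trans ?_ (L.measurePreserving.measure_preimage_emb
    L.toHomeomorph.measurableEmbedding _)
  congr 1
  ext v
  simp only [Set.mem_smul, Set.mem_image, Set.mem_preimage, Subtype.exists, exists_and_right,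
    exists_eq_right]
  constructor
  · rintro ⟨c, hc, w, ⟨hw, hw'⟩, rfl⟩
    exact ⟨c, hc, f ⟨w, hw⟩, ⟨(f ⟨w, hw⟩).2, hw'⟩, by rw [hf]; exact (L.map_smul c w).symm⟩
  · rintro ⟨c, hc, w, ⟨hw, hw'⟩, hv : c • w = L v⟩
    have hw1 : L.symm w ∈ Metric.sphere (0 : EuclideanSpace ℝ (Fin (n + 1))) 1 := by
      simpa using hw
    have hfw : f ⟨L.symm w, hw1⟩ = ⟨w, hw⟩ := Subtype.ext (by rw [hf]; exact L.apply_symm_apply w)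
    refine ⟨c, hc, L.symm w, ⟨hw1, by rwa [hfw]⟩, ?_⟩
    apply L.injective
    rw [L.map_smul, L.apply_symm_apply, hv]

lemma measurePreserving_neg : MeasurePreserving (fun x : UnitSphere n ↦ -x) (vol n) (vol n) :=
  measurePreserving_of_coe_eq (LinearIsometryEquiv.neg ℝ) fun _ ↦ rfl

/-- The reflection of the sphere in the hyperplane orthogonal to `w`. -/
noncomputable def reflect (w : EuclideanSpace ℝ (Fin (n + 1))) (x : UnitSphere n) : UnitSphere n :=
  ⟨(ℝ ∙ w)ᗮ.reflection x, by simp⟩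

section reflect

variable (w : EuclideanSpace ℝ (Fin (n + 1)))

lemma coe_reflect (x : UnitSphere n) :
    (reflect w x : EuclideanSpace ℝ (Fin (n + 1))) = (ℝ ∙ w)ᗮ.reflection x := rfl

lemma coe_reflect_eq_sub (x : UnitSphere n) :
    (reflect w x : EuclideanSpace ℝ (Fin (n + 1))) =
      x - (2 * ⟪w, (x : EuclideanSpace ℝ (Fin (n + 1)))⟫ / ‖w‖ ^ 2) • w := by
  rw [coe_reflect, Submodule.reflection_orthogonal_apply, Submodule.reflection_singleton_apply]
  rw [neg_sub, ← Nat.cast_smul_eq_nsmul ℝ, smul_smul]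
  congr 2
  simp
  ring

@[simp]
lemma reflect_reflect (x : UnitSphere n) : reflect w (reflect w x) = x := by
  ext1; simp [coe_reflect]

@[fun_prop]
lemma continuous_reflect : Continuous (reflect (n := n) w) :=
  Continuous.subtype_mk (by fun_prop) _

lemma measurePreserving_reflect : MeasurePreserving (reflect (n := n) w) (vol n) (vol n) :=
  measurePreserving_of_coe_eq _ (coe_reflect w)

@[simp]
lemma geodesicDist_reflect_reflect (x y : UnitSphere n) :
    geodesicDist (reflect w x) (reflect w y) = geodesicDist x y :=
  (ℝ ∙ w)ᗮ.reflection.toLinearIsometry.angle_map _ _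

lemma geodesicDist_reflect_left (x y : UnitSphere n) :
    geodesicDist (reflect w x) y = geodesicDist x (reflect w y) := by
  rw [← geodesicDist_reflect_reflect w, reflect_reflect]

@[simp]
lemma inner_reflect (x : UnitSphere n) :
    ⟪w, (reflect w x : EuclideanSpace ℝ (Fin (n + 1)))⟫ =
      -⟪w, (x : EuclideanSpace ℝ (Fin (n + 1)))⟫ := by
  rw [coe_reflect_eq_sub, inner_sub_right, real_inner_smul_right, real_inner_self_eq_norm_sq]
  by_cases hw : w = 0
  · simp [hw]
  · have : ‖w‖ ≠ 0 := norm_ne_zero_iff.mpr hw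
    field_simp
    ring

/-- Reflection changes `⟪x, y⟫` by `-2⟪w, x⟫⟪w, y⟫ / ‖w‖²`, which is nonnegative for points on
opposite sides. All uses of symmetrization rest on this. -/
lemma geodesicDist_reflect_le {x y : UnitSphere n}
    (h : ⟪w, (x : EuclideanSpace ℝ (Fin (n + 1)))⟫ * ⟪w, (y : EuclideanSpace ℝ (Fin (n + 1)))⟫ ≤ 0) :
    geodesicDist x (reflect w y) ≤ geodesicDist x y := by
  rw [geodesicDist_le_geodesicDist_iff, coe_reflect_eq_sub, inner_sub_right, real_inner_smul_right,
    real_inner_comm w, le_sub_self_iff, div_mul_eq_mul_div]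
  exact div_nonpos_of_nonpos_of_nonneg (by linarith) (by positivity)

lemma reflect_sub_left (x y : UnitSphere n) :
    reflect ((x : EuclideanSpace ℝ (Fin (n + 1))) - (y : EuclideanSpace ℝ (Fin (n + 1)))) x = y :=
  Subtype.ext (Submodule.reflection_sub (by rw [norm_eq_of_mem_sphere, norm_eq_of_mem_sphere]))

lemma inner_sub_nonneg_iff {x y p : UnitSphere n} :
    0 ≤ ⟪(x : EuclideanSpace ℝ (Fin (n + 1))) - (y : EuclideanSpace ℝ (Fin (n + 1))),
      (p : EuclideanSpace ℝ (Fin (n + 1)))⟫ ↔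
      geodesicDist x p ≤ geodesicDist y p := by
  rw [geodesicDist_le_geodesicDist_iff, inner_sub_left, sub_nonneg]

end reflect

/-- Balls of the same radius have the same volume. -/
lemma vol_setOf_geodesicDist_mem_eq (z z' : UnitSphere n) {s : Set ℝ} (hs : MeasurableSet s) :
    vol n {x | geodesicDist x z ∈ s} = vol n {x | geodesicDist x z' ∈ s} := by
  have hmeas : MeasurableSet {x : UnitSphere n | geodesicDist x z' ∈ s} :=
    (continuous_geodesicDist_left z').measurable hs
  rw [← (measurePreserving_reflect ((z : EuclideanSpace ℝ (Fin (n + 1))) -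
    (z' : EuclideanSpace ℝ (Fin (n + 1))))).measure_preimage hmeas.nullMeasurableSet]
  congr 1
  ext x
  rw [mem_preimage, mem_ofPred_eq, mem_ofPred_eq, ← geodesicDist_reflect_reflect
    ((z : EuclideanSpace ℝ (Fin (n + 1))) - (z' : EuclideanSpace ℝ (Fin (n + 1)))) x z,
    reflect_sub_left]

instance : IsFiniteMeasure (vol n) := inferInstanceAs (IsFiniteMeasure (Measure.toSphere _))

instance : (vol n).IsOpenPosMeasure :=
  inferInstanceAs (Measure.IsOpenPosMeasure (Measure.toSphere _))

/-! ### Geodesic neighbourhoods -/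

/-- The open geodesic neighbourhood of radius `t` of `Z`. -/
def geodesicThickening (t : ℝ) (Z : Set (UnitSphere n)) : Set (UnitSphere n) :=
  {x | ∃ y ∈ Z, geodesicDist x y < t}

/-- The closed geodesic neighbourhood of radius `t` of a closed set `Z`. -/
def geodesicCthickening (t : ℝ) (Z : Set (UnitSphere n)) : Set (UnitSphere n) :=
  {x | ∃ y ∈ Z, geodesicDist x y ≤ t}

lemma isOpen_geodesicThickening (t : ℝ) (Z : Set (UnitSphere n)) :
    IsOpen (geodesicThickening t Z) := by
  have : geodesicThickening t Z = ⋃ y ∈ Z, {x | geodesicDist x y < t} := by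
    ext x; simp [geodesicThickening]
  rw [this]
  exact isOpen_biUnion fun y _ ↦ isOpen_setOf_geodesicDist_lt y t

lemma geodesicThickening_mono {s t : ℝ} (h : s ≤ t) (Z : Set (UnitSphere n)) :
    geodesicThickening s Z ⊆ geodesicThickening t Z :=
  fun _ ⟨y, hy, hxy⟩ ↦ ⟨y, hy, hxy.trans_le h⟩

/-- The distance to a nonempty closed set is attained. -/
lemma exists_geodesicDist_le_of_isClosed {Z : Set (UnitSphere n)} (hZ : IsClosed Z)
    (hne : Z.Nonempty) (x : UnitSphere n) :
    ∃ y ∈ Z, ∀ z ∈ Z, geodesicDist x y ≤ geodesicDist x z := by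
  obtain ⟨y, hy, hmin⟩ := hZ.isCompact.exists_isMinOn hne
    (continuous_geodesicDist_right x).continuousOn
  exact ⟨y, hy, fun z hz ↦ hmin hz⟩

/-- The farthest distance to a nonempty closed set is attained. -/
lemma exists_le_geodesicDist_of_isClosed {Z : Set (UnitSphere n)} (hZ : IsClosed Z)
    (hne : Z.Nonempty) (x : UnitSphere n) :
    ∃ y ∈ Z, ∀ z ∈ Z, geodesicDist x z ≤ geodesicDist x y := by
  obtain ⟨y, hy, hmax⟩ := hZ.isCompact.exists_isMaxOn hne
    (continuous_geodesicDist_right x).continuousOn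
  exact ⟨y, hy, fun z hz ↦ hmax hz⟩

lemma geodesicCthickening_eq_iInter {Z : Set (UnitSphere n)} (hZ : IsClosed Z) (t : ℝ) :
    geodesicCthickening t Z = ⋂ s > t, geodesicThickening s Z := by
  ext x
  simp only [mem_iInter]
  constructor
  · rintro ⟨y, hy, hxy⟩ s hs
    exact ⟨y, hy, hxy.trans_lt hs⟩
  · intro h
    obtain ⟨y, hy, hmin⟩ := exists_geodesicDist_le_of_isClosed hZ
      (by obtain ⟨y, hy, -⟩ := h (t + 1) (by simp); exact ⟨y, hy⟩) x
    refine ⟨y, hy, le_of_forall_gt fun s hs ↦ ?_⟩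
    obtain ⟨z, hz, hxz⟩ := h s hs
    exact (hmin z hz).trans_lt hxz

lemma geodesicThickening_eq_iUnion (Z : Set (UnitSphere n)) (t : ℝ) :
    geodesicThickening t Z = ⋃ k : ℕ, geodesicThickening (t - 1 / (k + 1)) Z := by
  ext x
  simp only [mem_iUnion]
  constructor
  · rintro ⟨y, hy, hxy⟩
    obtain ⟨k, hk⟩ := exists_nat_one_div_lt (sub_pos.mpr hxy)
    exact ⟨k, y, hy, by linarith⟩
  · rintro ⟨k, hk⟩
    exact geodesicThickening_mono (by have : (0 : ℝ) < 1 / (k + 1) := by positivity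
                                      linarith) Z hk

lemma setOf_geodesicDist_lt_subset_geodesicThickening (hn : 1 ≤ n) (z : UnitSphere n) {r t : ℝ}
    (hr : 0 ≤ r) (ht : 0 < t) :
    {x | geodesicDist x z < r + t} ⊆ geodesicThickening t (geodesicBall z r) := by
  intro x hx
  rw [mem_ofPred_eq] at hx
  rcases le_or_gt (geodesicDist x z) r with h | h
  · exact ⟨x, h, by simpa using ht⟩
  · obtain ⟨m, hm, hxm⟩ := exists_geodesicDist_eq hn x z hr h.le
    exact ⟨m, hm.le, by linarith⟩

/-- A nonempty relatively open part of a ball meets the open ball. -/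
lemma exists_geodesicDist_lt_notMem (hn : 1 ≤ n) {z b : UnitSphere n} {r : ℝ} (hr : 0 < r)
    {Z : Set (UnitSphere n)} (hZ : IsClosed Z) (hb : b ∈ geodesicBall z r) (hbZ : b ∉ Z) :
    ∃ b', geodesicDist b' z < r ∧ b' ∉ Z := by
  obtain ⟨u, h, hx⟩ := exists_greatCircle_eq hn z b
  rcases lt_or_ge (geodesicDist b z) r with hlt | hge
  · exact ⟨b, hlt, hbZ⟩
  have hev : ∀ᶠ s in 𝓝 (geodesicDist b z), greatCircle z u h s ∉ Z :=
    (continuous_greatCircle h).continuousAt.eventually_mem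
      (hZ.isOpen_compl.mem_nhds (by rwa [hx]))
  obtain ⟨s, hsZ, hs0, hs⟩ := ((hev.filter_mono nhdsWithin_le_nhds).and
    (Ioo_mem_nhdsLT (hr.trans_le hge))).exists
  refine ⟨_, ?_, hsZ⟩
  have hpi := geodesicDist_le_pi b z
  have := geodesicDist_greatCircle h (s := s) (t := 0)
    (by rw [sub_zero, abs_of_pos hs0]; linarith)
  rw [greatCircle_zero, sub_zero, abs_of_pos hs0] at this
  rw [this]
  exact hs.trans_le hb

/-! ### Two-point symmetrization -/

/-- The two-point symmetrization of `Z` with respect to the hyperplane orthogonal to `w`, towards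
the side containing `w`. -/
def twoPoint (w : EuclideanSpace ℝ (Fin (n + 1))) (Z : Set (UnitSphere n)) : Set (UnitSphere n) :=
  {x | (x ∈ Z ∧ reflect w x ∈ Z) ∨
    (0 ≤ ⟪w, (x : EuclideanSpace ℝ (Fin (n + 1)))⟫ ∧ (x ∈ Z ∨ reflect w x ∈ Z))}

/-- The part of `Z` that is moved by the two-point symmetrization. -/
def twoPointMoved (w : EuclideanSpace ℝ (Fin (n + 1))) (Z : Set (UnitSphere n)) :
    Set (UnitSphere n) :=
  {x | x ∈ Z ∧ reflect w x ∉ Z ∧ ⟪w, (x : EuclideanSpace ℝ (Fin (n + 1)))⟫ < 0}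

section twoPoint

variable (w : EuclideanSpace ℝ (Fin (n + 1)))

lemma isClosed_twoPoint {Z : Set (UnitSphere n)} (hZ : IsClosed Z) : IsClosed (twoPoint w Z) := by
  have hσ : IsClosed {x | reflect w x ∈ Z} := hZ.preimage (continuous_reflect w)
  have hH : IsClosed {x : UnitSphere n | 0 ≤ ⟪w, (x : EuclideanSpace ℝ (Fin (n + 1)))⟫} :=
    isClosed_le continuous_const (by fun_prop)
  exact (hZ.inter hσ).union (hH.inter (hZ.union hσ))

lemma nonempty_twoPoint {Z : Set (UnitSphere n)} (hZ : Z.Nonempty) : (twoPoint w Z).Nonempty := by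
  obtain ⟨x, hx⟩ := hZ
  rcases le_total 0 ⟪w, (x : EuclideanSpace ℝ (Fin (n + 1)))⟫ with h | h
  · exact ⟨x, Or.inr ⟨h, Or.inl hx⟩⟩
  · exact ⟨reflect w x, Or.inr ⟨by simpa using h, Or.inr (by simpa using hx)⟩⟩

lemma twoPoint_subset (Z : Set (UnitSphere n)) {x : UnitSphere n} (hx : x ∈ twoPoint w Z) :
    x ∈ Z ∨ reflect w x ∈ Z := by
  rcases hx with h | h
  exacts [Or.inl h.1, h.2]

lemma twoPoint_eq (Z : Set (UnitSphere n)) :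
    twoPoint w Z = (Z \ twoPointMoved w Z) ∪ reflect w ⁻¹' twoPointMoved w Z := by
  ext x
  simp only [twoPoint, twoPointMoved, mem_union, Set.mem_sdiff, mem_preimage, mem_ofPred_eq,
    reflect_reflect, inner_reflect, neg_lt_zero]
  have h0 : ⟪w, (x : EuclideanSpace ℝ (Fin (n + 1)))⟫ = 0 → reflect w x = x := by
    intro h
    ext1
    rw [coe_reflect_eq_sub, h]
    simp
  rcases lt_trichotomy ⟪w, (x : EuclideanSpace ℝ (Fin (n + 1)))⟫ 0 with h | h | h
  · simp only [h, not_le.mpr h, not_lt.mpr h.le]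
    tauto
  · simp [h0 h, h]
  · simp only [h, h.le, not_lt.mpr h.le]
    tauto

lemma measurableSet_twoPointMoved {Z : Set (UnitSphere n)} (hZ : MeasurableSet Z) :
    MeasurableSet (twoPointMoved w Z) := by
  refine hZ.inter (((continuous_reflect w).measurable hZ).compl.inter ?_)
  have hc : Continuous fun x : UnitSphere n ↦ ⟪w, (x : EuclideanSpace ℝ (Fin (n + 1)))⟫ := by
    fun_prop
  exact (isOpen_lt hc continuous_const).measurableSet

/-- Symmetrizing replaces the moved part by its mirror image, which is disjoint from `Z`. The
additive form avoids subtraction in `ℝ≥0∞`. -/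
lemma vol_twoPoint_inter_add {Z B : Set (UnitSphere n)} (hZ : MeasurableSet Z) (hB : MeasurableSet B) :
    vol n (twoPoint w Z ∩ B) + vol n (twoPointMoved w Z ∩ B) =
      vol n (Z ∩ B) + vol n (reflect w ⁻¹' twoPointMoved w Z ∩ B) := by
  have hW := measurableSet_twoPointMoved w hZ
  have hσW : MeasurableSet (reflect w ⁻¹' twoPointMoved w Z) := (continuous_reflect w).measurable hW
  have hsub : twoPointMoved w Z ⊆ Z := fun x hx ↦ hx.1
  have h1 : vol n (twoPoint w Z ∩ B) =
      vol n ((Z \ twoPointMoved w Z) ∩ B) + vol n (reflect w ⁻¹' twoPointMoved w Z ∩ B) := by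
    rw [twoPoint_eq, union_inter_distrib_right, measure_union _ (hσW.inter hB)]
    refine Disjoint.mono inter_subset_left inter_subset_left (disjoint_left.mpr ?_)
    rintro x hx ⟨-, hx', -⟩
    rw [reflect_reflect] at hx'
    exact hx' hx.1
  have h2 : vol n (Z ∩ B) =
      vol n ((Z \ twoPointMoved w Z) ∩ B) + vol n (twoPointMoved w Z ∩ B) := by
    rw [← measure_union _ (hW.inter hB), ← union_inter_distrib_right, sdiff_union_of_subset hsub]
    exact Disjoint.mono inter_subset_left inter_subset_left disjoint_sdiff_left
  rw [h1, h2]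
  ring

lemma vol_twoPoint {Z : Set (UnitSphere n)} (hZ : MeasurableSet Z) :
    vol n (twoPoint w Z) = vol n Z := by
  have h := vol_twoPoint_inter_add w hZ MeasurableSet.univ
  simp only [inter_univ] at h
  rw [(measurePreserving_reflect w).measure_preimage
    (measurableSet_twoPointMoved w hZ).nullMeasurableSet] at h
  exact (ENNReal.add_left_inj (measure_ne_top _ _)).mp h

/-- Two-point symmetrization does not increase neighbourhoods. -/
lemma geodesicThickening_twoPoint_subset (t : ℝ) (Z : Set (UnitSphere n)) :
    geodesicThickening t (twoPoint w Z) ⊆ twoPoint w (geodesicThickening t Z) := by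
  rintro x ⟨y, hy, hxy⟩
  have hσxy : geodesicDist (reflect w x) (reflect w y) < t := by simpa using hxy
  have h1 : y ∈ Z → x ∈ geodesicThickening t Z := fun h ↦ ⟨y, h, hxy⟩
  have h2 : reflect w y ∈ Z → reflect w x ∈ geodesicThickening t Z := fun h ↦ ⟨_, h, hσxy⟩
  rcases hy with ⟨hy, hy'⟩ | ⟨hy, hy'⟩
  · exact Or.inl ⟨h1 hy, h2 hy'⟩
  · rcases le_or_gt 0 ⟪w, (x : EuclideanSpace ℝ (Fin (n + 1)))⟫ with hx | hx
    · exact Or.inr ⟨hx, hy'.imp h1 h2⟩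
    · have hxσy : geodesicDist x (reflect w y) < t :=
        (geodesicDist_reflect_le w (mul_nonpos_of_nonpos_of_nonneg hx.le hy)).trans_lt hxy
      have hσxy' : geodesicDist (reflect w x) y < t := by
        rwa [geodesicDist_reflect_left]
      refine Or.inl ?_
      rcases hy' with hy' | hy'
      · exact ⟨h1 hy', y, hy', hσxy'⟩
      · exact ⟨⟨_, hy', hxσy⟩, h2 hy'⟩

lemma vol_geodesicThickening_twoPoint_le (t : ℝ) (Z : Set (UnitSphere n)) :
    vol n (geodesicThickening t (twoPoint w Z)) ≤ vol n (geodesicThickening t Z) :=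
  (measure_mono (geodesicThickening_twoPoint_subset w t Z)).trans_eq
    (vol_twoPoint w (isOpen_geodesicThickening t Z).measurableSet)

end twoPoint

/-- If a closed set has a part of positive volume outside a ball and does not contain the ball, then
some two-point symmetrization increases its intersection with the ball. -/
lemma exists_vol_inter_lt_vol_twoPoint_inter (hn : 1 ≤ n) {Z : Set (UnitSphere n)} (hZ : IsClosed Z)
    {z : UnitSphere n} {r : ℝ} (hr : 0 < r) (hpos : vol n (Z \ geodesicBall z r) ≠ 0)
    (hB : ¬ geodesicBall z r ⊆ Z) :
    ∃ w : EuclideanSpace ℝ (Fin (n + 1)),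
      vol n (Z ∩ geodesicBall z r) < vol n (twoPoint w Z ∩ geodesicBall z r) := by
  have hc (v : EuclideanSpace ℝ (Fin (n + 1))) :
      Continuous fun x : UnitSphere n ↦ ⟪v, (x : EuclideanSpace ℝ (Fin (n + 1)))⟫ := by fun_prop
  obtain ⟨b₀, hb₀, hb₀Z⟩ := not_subset.mp hB
  obtain ⟨b, hb, hbZ⟩ := exists_geodesicDist_lt_notMem hn hr hZ hb₀ hb₀Z
  -- Every neighbourhood of `a` meets `Z \ B` in positive volume; reflecting `a` to `b` brings such
  -- a piece into the gap around `b`.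
  obtain ⟨a, ha, hasupp⟩ := exists_mem_forall_mem_nhdsWithin_pos_measure hpos
  set B := geodesicBall z r
  have hBm : MeasurableSet B := (isClosed_geodesicBall z r).measurableSet
  have haB : r < geodesicDist a z := not_le.mp ha.2
  set w : EuclideanSpace ℝ (Fin (n + 1)) :=
    (b : EuclideanSpace ℝ (Fin (n + 1))) - (a : EuclideanSpace ℝ (Fin (n + 1))) with hw
  have hwb : reflect w b = a := reflect_sub_left b a
  have hwa : reflect w a = b := by rw [← hwb, reflect_reflect]
  have hwz : 0 ≤ ⟪w, (z : EuclideanSpace ℝ (Fin (n + 1)))⟫ :=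
    inner_sub_nonneg_iff.mpr (hb.trans haB).le
  have hwa0 : ⟪w, (a : EuclideanSpace ℝ (Fin (n + 1)))⟫ < 0 := by
    rw [← not_le, inner_sub_nonneg_iff, geodesicDist_self, not_le]
    refine (geodesicDist_nonneg _ _).lt_of_ne' fun h ↦ ?_
    rw [eq_of_geodesicDist_eq_zero h] at hb
    exact lt_asymm hb haB
  refine ⟨w, ?_⟩
  set W := twoPointMoved w Z
  have hW : MeasurableSet W := measurableSet_twoPointMoved w hZ.measurableSet
  have hσm : Measurable (reflect (n := n) w) := (continuous_reflect w).measurable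
  -- Nothing is lost: the centre `z` is on the receiving side, so moved points of `B` stay in `B`.
  have hside : W ∩ B ⊆ reflect w ⁻¹' B := by
    rintro x ⟨⟨-, -, hx⟩, hxB⟩
    change geodesicDist _ _ ≤ r
    rw [geodesicDist_comm]
    refine (geodesicDist_reflect_le w (mul_nonpos_of_nonneg_of_nonpos hwz hx.le)).trans ?_
    rw [geodesicDist_comm]
    exact hxB
  have hgain : 0 < vol n ((W \ B) ∩ reflect w ⁻¹' B) := by
    have hU : {x | reflect w x ∉ Z ∧ ⟪w, (x : EuclideanSpace ℝ (Fin (n + 1)))⟫ < 0 ∧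
        geodesicDist (reflect w x) z < r} ∈ 𝓝 a := by
      refine IsOpen.mem_nhds ?_ ⟨by rwa [hwa], hwa0, by rwa [hwa]⟩
      refine (hZ.isOpen_compl.preimage (continuous_reflect w)).inter (IsOpen.inter ?_ ?_)
      · exact isOpen_lt (hc w) continuous_const
      · exact (isOpen_setOf_geodesicDist_lt z r).preimage (continuous_reflect w)
    refine (hasupp _ (inter_mem (mem_nhdsWithin_of_mem_nhds hU) self_mem_nhdsWithin)).trans_le
      (measure_mono ?_)
    rintro x ⟨⟨h1, h2, h3⟩, h4, h5⟩
    exact ⟨⟨⟨h4, h1, h2⟩, h5⟩, h3.le⟩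
  have hge : vol n (W ∩ B) + vol n ((W \ B) ∩ reflect w ⁻¹' B) ≤ vol n (reflect w ⁻¹' W ∩ B) := by
    rw [← measure_union (disjoint_left.mpr fun x hx hx' ↦
      hx'.1.2 hx.2)
      ((hW.diff hBm).inter (hσm hBm)), ← (measurePreserving_reflect w).measure_preimage
      ((hW.inter hBm).union ((hW.diff hBm).inter (hσm hBm))).nullMeasurableSet]
    refine measure_mono ?_
    rintro x (hx | hx)
    · exact ⟨hx.1, by simpa using hside hx⟩
    · exact ⟨hx.1.1, by simpa using hx.2⟩
  have hid := vol_twoPoint_inter_add w hZ.measurableSet hBm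
  by_contra! hcon
  have h1 : vol n (Z ∩ B) + (vol n (W ∩ B) + vol n ((W \ B) ∩ reflect w ⁻¹' B)) ≤
      vol n (Z ∩ B) + vol n (W ∩ B) := by
    calc _ ≤ vol n (Z ∩ B) + vol n (reflect w ⁻¹' W ∩ B) := by gcongr
      _ = vol n (twoPoint w Z ∩ B) + vol n (W ∩ B) := hid.symm
      _ ≤ _ := by gcongr
  rw [← add_assoc] at h1
  have hfin : vol n (Z ∩ B) + vol n (W ∩ B) ≠ ∞ :=
    ENNReal.add_ne_top.mpr ⟨measure_ne_top _ _, measure_ne_top _ _⟩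
  exact hgain.not_ge ((ENNReal.add_le_add_iff_left hfin).mp (h1.trans_eq (add_zero _).symm))

/-! ### The isoperimetric inequality -/

lemma exists_dist_lt_of_dist_lt_nonemptyCompacts {α : Type*} [MetricSpace α]
    {Z Z' : TopologicalSpace.NonemptyCompacts α} {δ : ℝ} (h : dist Z Z' < δ) {x : α} (hx : x ∈ Z) :
    ∃ y ∈ Z', dist x y < δ :=
  Metric.exists_dist_lt_of_hausdorffDist_lt (s := (Z : Set α)) (t := Z') hx
    (by rwa [← Metric.NonemptyCompacts.dist_eq]) (edist_ne_top Z Z')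

/-- Compact sets near `Z` lie in a small closed thickening of `Z`, whose measure tends to that of
`Z`. -/
lemma upperSemicontinuous_measure_nonemptyCompacts {α : Type*} [MetricSpace α] [ProperSpace α]
    [MeasurableSpace α] [BorelSpace α] (μ : Measure α) [IsFiniteMeasureOnCompacts μ] :
    UpperSemicontinuous fun Z : TopologicalSpace.NonemptyCompacts α ↦ μ Z := by
  intro Z c hc
  obtain ⟨δ, hδ, hδ'⟩ := Metric.eventually_nhds_iff.mp
    ((tendsto_measure_cthickening_of_isCompact Z.isCompact (μ := μ)).eventually_lt_const hc)
  filter_upwards [Metric.ball_mem_nhds Z (half_pos hδ)] with Z' hZ'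
  refine (measure_mono fun x hx ↦ ?_).trans_lt (hδ' (y := δ / 2) (by
    rw [dist_zero_right, norm_of_nonneg (by positivity)]; linarith))
  obtain ⟨y, hy, hxy⟩ := exists_dist_lt_of_dist_lt_nonemptyCompacts hZ' hx
  exact Metric.mem_cthickening_of_dist_le x y _ _ hy hxy.le

/-- The open neighbourhood is exhausted by smaller ones, each contained in the `t`-neighbourhood of
every `Z'` close enough to `Z`. -/
lemma lowerSemicontinuous_vol_geodesicThickening (t : ℝ) :
    LowerSemicontinuous fun Z : TopologicalSpace.NonemptyCompacts (UnitSphere n) ↦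
      vol n (geodesicThickening t Z) := by
  intro Z c hc
  change c < vol n (geodesicThickening t Z) at hc
  rw [geodesicThickening_eq_iUnion, (directed_of_isDirected_le ?_).measure_iUnion] at hc
  · obtain ⟨k, hk⟩ := lt_iSup_iff.mp hc
    have hk0 : (0 : ℝ) < 1 / (k + 1) := by positivity
    filter_upwards [Metric.ball_mem_nhds Z (ε := 1 / (k + 1) / (π / 2)) (by positivity)]
      with Z' hZ'
    refine hk.trans_le (measure_mono ?_)
    rintro x ⟨y, hy, hxy⟩
    obtain ⟨y', hy', hyy'⟩ := exists_dist_lt_of_dist_lt_nonemptyCompacts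
      (by rw [dist_comm]; exact hZ') hy
    refine ⟨y', hy', (geodesicDist_triangle x y y').trans_lt ?_⟩
    have h1 := geodesicDist_le_dist y y'
    rw [lt_div_iff₀ (by positivity), mul_comm] at hyy'
    linarith
  · intro k l hkl
    refine geodesicThickening_mono ?_ _
    have : (1 : ℝ) / (l + 1) ≤ 1 / (k + 1) := one_div_le_one_div_of_le (by positivity) (by
      gcongr)
    linarith

/-- The isoperimetric inequality on the sphere for open neighbourhoods. -/
lemma vol_lt_le_vol_geodesicThickening (hn : 1 ≤ n) {Y : Set (UnitSphere n)} (hY : IsClosed Y)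
    (hne : Y.Nonempty) (z : UnitSphere n) {r t : ℝ} (hr : 0 < r) (ht : 0 < t)
    (hV : vol n (geodesicBall z r) ≤ vol n Y) :
    vol n {x | geodesicDist x z < r + t} ≤ vol n (geodesicThickening t Y) := by
  set B := geodesicBall z r
  have hBm : MeasurableSet B := (isClosed_geodesicBall z r).measurableSet
  set K : Set (TopologicalSpace.NonemptyCompacts (UnitSphere n)) :=
    {Z | vol n B ≤ vol n Z ∧ vol n (geodesicThickening t Z) ≤ vol n (geodesicThickening t Y)}
    with hK
  have hKc : IsClosed K :=
    ((upperSemicontinuous_measure_nonemptyCompacts (vol n)).isClosed_preimage _).inter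
      ((lowerSemicontinuous_vol_geodesicThickening t).isClosed_preimage _)
  -- Maximize the overlap with `B`: an upper semicontinuous function on a compact class.
  obtain ⟨Z, ⟨hZ1, hZ2⟩, hmax⟩ :=
    UpperSemicontinuousOn.exists_isMaxOn (s := K) ⟨⟨⟨Y, hY.isCompact⟩, hne⟩, hV, le_rfl⟩
      hKc.isCompact ((upperSemicontinuous_measure_nonemptyCompacts
        ((vol n).restrict B)).upperSemicontinuousOn K)
  by_cases hBZ : B ⊆ Z
  · refine le_trans (measure_mono ?_) hZ2
    refine (setOf_geodesicDist_lt_subset_geodesicThickening hn z hr.le ht).trans ?_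
    rintro x ⟨y, hy, hxy⟩
    exact ⟨y, hBZ hy, hxy⟩
  · exfalso
    have hZc : IsClosed (Z : Set (UnitSphere n)) := Z.isCompact.isClosed
    have hpos : vol n ((Z : Set (UnitSphere n)) \ B) ≠ 0 := by
      intro h0
      obtain ⟨b₀, hb₀, hb₀Z⟩ := not_subset.mp hBZ
      obtain ⟨b, hb, hbZ⟩ := exists_geodesicDist_lt_notMem hn hr hZc hb₀ hb₀Z
      have hgap : 0 < vol n (B \ Z) := by
        refine ((IsOpen.inter (isOpen_setOf_geodesicDist_lt z r) hZc.isOpen_compl).measure_pos _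
          ⟨b, hb, hbZ⟩).trans_le (measure_mono fun x hx ↦ ⟨?_, hx.2⟩)
        have hxr : geodesicDist x z < r := hx.1
        exact hxr.le
      rw [← measure_inter_add_sdiff B hZc.measurableSet,
        ← measure_inter_add_sdiff (Z : Set (UnitSphere n)) hBm, h0, inter_comm] at hZ1
      exact hgap.not_ge ((ENNReal.add_le_add_iff_left (measure_ne_top _ _)).mp hZ1)
    obtain ⟨w, hw⟩ := exists_vol_inter_lt_vol_twoPoint_inter hn hZc hr hpos hBZ
    have hmem : (⟨⟨twoPoint w Z, (isClosed_twoPoint w hZc).isCompact⟩,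
        nonempty_twoPoint w Z.nonempty⟩ : TopologicalSpace.NonemptyCompacts (UnitSphere n)) ∈ K :=
      ⟨hZ1.trans_eq (vol_twoPoint w hZc.measurableSet).symm,
        (vol_geodesicThickening_twoPoint_le w t Z).trans hZ2⟩
    have := hmax hmem
    simp only [mem_ofPred_eq, Measure.restrict_apply' hBm] at this
    exact hw.not_ge this

/-- The isoperimetric inequality on the sphere for closed neighbourhoods. -/
lemma vol_geodesicBall_le_vol_geodesicCthickening (hn : 1 ≤ n) {Y : Set (UnitSphere n)}
    (hY : IsClosed Y) (hne : Y.Nonempty) (z : UnitSphere n) {r t : ℝ} (hr : 0 < r) (ht : 0 < t)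
    (hV : vol n (geodesicBall z r) ≤ vol n Y) :
    vol n (geodesicBall z (r + t)) ≤ vol n (geodesicCthickening t Y) := by
  rw [geodesicCthickening_eq_iInter hY]
  have hlim : Tendsto (fun s ↦ vol n (geodesicThickening s Y)) (𝓝[>] t)
      (𝓝 (vol n (⋂ s > t, geodesicThickening s Y))) :=
    tendsto_measure_biInter_gt (fun s _ ↦ (isOpen_geodesicThickening s Y).nullMeasurableSet)
      (fun _ _ _ h ↦ geodesicThickening_mono h Y) ⟨t + 1, by simp, measure_ne_top _ _⟩
  refine ge_of_tendsto hlim (eventually_mem_nhdsWithin.mono fun s hs ↦ ?_)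
  have hs : t < s := hs
  refine le_trans (measure_mono fun x hx ↦ ?_)
    (vol_lt_le_vol_geodesicThickening hn hY hne z hr (ht.trans hs) hV)
  have hx : geodesicDist x z ≤ r + t := hx
  change geodesicDist x z < r + s
  linarith

/-! ### Extremal sets for the isodiametric problem -/

/-- Nonempty closed sets of diameter at most `D` with at least the volume of a ball of
radius `D / 2`. -/
structure IsIsodiametric (D : ℝ) (X : Set (UnitSphere n)) : Prop where
  isClosed : IsClosed X
  nonempty : X.Nonempty
  geodesicDist_le : ∀ x ∈ X, ∀ y ∈ X, geodesicDist x y ≤ D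
  vol_le (z : UnitSphere n) : vol n (geodesicBall z (D / 2)) ≤ vol n X

namespace IsIsodiametric

variable {D t : ℝ} {X : Set (UnitSphere n)}

/-- Each point outside the `t`-neighbourhood of an extremal set is at distance at least `D + t` from
some point of the set. -/
lemma exists_add_le_geodesicDist (hX : IsIsodiametric D X) (hn : 1 ≤ n) (hD : 0 < D) (ht : 0 < t)
    (htD : D + t < π) {p : UnitSphere n} (hp : ∀ x ∈ X, t ≤ geodesicDist p x) :
    ∃ y ∈ X, D + t ≤ geodesicDist p y := by
  obtain ⟨y, hy, hmax⟩ := exists_le_geodesicDist_of_isClosed hX.isClosed hX.nonempty p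
  refine ⟨y, hy, ?_⟩
  by_contra! hlt
  -- The slack `η` leaves room for an open `η`-ball about `p` disjoint from both `A` and `B` below.
  obtain ⟨η, hη, hηt, hηy⟩ : ∃ η > 0, η < t ∧ geodesicDist p y + 2 * η < D + t := by
    refine ⟨min t (D + t - geodesicDist p y) / 4, ?_, ?_, ?_⟩
    · have : 0 < min t (D + t - geodesicDist p y) := lt_min ht (by linarith)
      positivity
    · linarith [min_le_left t (D + t - geodesicDist p y)]
    · linarith [min_le_right t (D + t - geodesicDist p y)]
  obtain ⟨z, -⟩ := hX.nonempty
  set s := t - η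
  have hA := vol_geodesicBall_le_vol_geodesicCthickening hn hX.isClosed hX.nonempty z
    (r := D / 2) (t := s) (by linarith) (by linarith) (hX.vol_le z)
  have hB := vol_lt_le_vol_geodesicThickening hn hX.isClosed hX.nonempty z
    (r := D / 2) (t := π - D - s) (by linarith) (by linarith) (hX.vol_le z)
  set A := geodesicCthickening s X
  set B : Set (UnitSphere n) := (fun x ↦ -x) ⁻¹' geodesicThickening (π - D - s) X
  set C : Set (UnitSphere n) := {x | geodesicDist x p < η}
  have hBo : IsOpen B := (isOpen_geodesicThickening _ X).preimage continuous_neg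
  have hCo : IsOpen C := isOpen_setOf_geodesicDist_lt p η
  have hBvol : vol n B = vol n (geodesicThickening (π - D - s) X) :=
    measurePreserving_neg.measure_preimage
      (isOpen_geodesicThickening _ X).measurableSet.nullMeasurableSet
  have hAB : Disjoint A B := by
    rw [disjoint_left]
    rintro x ⟨y, hy, hxy⟩ ⟨y', hy', hxy'⟩
    rw [geodesicDist_comm, geodesicDist_neg_right] at hxy'
    have := geodesicDist_triangle y' y x
    rw [geodesicDist_comm y x] at this
    linarith [hX.geodesicDist_le y' hy' y hy]
  have hABC : Disjoint (A ∪ B) C := by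
    rw [disjoint_left]
    rintro x (⟨y', hy', hxy⟩ | ⟨y', hy', hxy⟩) (hx : geodesicDist x p < η)
    · have := geodesicDist_triangle p x y'
      rw [geodesicDist_comm p x] at this
      linarith [hp y' hy']
    · rw [geodesicDist_comm, geodesicDist_neg_right] at hxy
      have := geodesicDist_triangle y' p x
      rw [geodesicDist_comm p x, geodesicDist_comm y' p] at this
      linarith [hmax y' hy']
  have hsum : vol n A + vol n B + vol n C ≤ vol n univ := by
    rw [← measure_union hAB hBo.measurableSet, ← measure_union hABC hCo.measurableSet]
    exact measure_mono (subset_univ _)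
  -- The radii `D / 2 + s` and `D / 2 + (π - D - s)` sum to `π`, so the two comparison balls, one
  -- closed and one open, are complementary after an antipodal map.
  have huniv : vol n univ ≤ vol n A + vol n B := by
    have hball : MeasurableSet (geodesicBall z (D / 2 + s)) :=
      (isClosed_geodesicBall z _).measurableSet
    rw [← measure_add_measure_compl hball, hBvol]
    refine add_le_add hA (le_trans ?_ hB)
    rw [← measurePreserving_neg.measure_preimage
      (isOpen_setOf_geodesicDist_lt z _).measurableSet.nullMeasurableSet]
    refine measure_mono fun x hx ↦ ?_
    have hx : ¬ geodesicDist x z ≤ D / 2 + s := hx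
    change geodesicDist (-x) z < _
    rw [geodesicDist_comm, geodesicDist_neg_right, geodesicDist_comm]
    linarith
  have hC : 0 < vol n C := hCo.measure_pos _ ⟨p, by simpa [C] using hη⟩
  have h := hsum.trans (huniv.trans_eq (add_zero _).symm)
  exact hC.not_ge ((ENNReal.add_le_add_iff_left
    (ENNReal.add_ne_top.mpr ⟨measure_ne_top _ _, measure_ne_top _ _⟩)).mp h)

/-- The nearest point of an extremal set is unique, for points close to the set. -/
lemma eq_of_geodesicDist_eq (hX : IsIsodiametric D X) (hn : 1 ≤ n) (hD : 0 < D) (ht : 0 < t)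
    (htD : D + t < π) {p x x' : UnitSphere n} (hp : ∀ x ∈ X, t ≤ geodesicDist p x) (hx : x ∈ X)
    (hx' : x' ∈ X) (hpx : geodesicDist p x = t) (hpx' : geodesicDist p x' = t) : x = x' := by
  obtain ⟨y, hy, hpy⟩ := hX.exists_add_le_geodesicDist hn hD ht htD hp
  -- `D + t ≤ d(p, y) ≤ t + d(x, y) ≤ t + D` forces equality throughout, and likewise for `x'`.
  have h1 := geodesicDist_triangle p x y
  have h2 := geodesicDist_triangle p x' y
  have h3 := hX.geodesicDist_le x hx y hy
  have h4 := hX.geodesicDist_le x' hx' y hy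
  exact eq_of_geodesicDist_eq_add (s := D) (by linarith) htD hpx hpx' (by linarith) (by linarith)
    (by linarith)

/-- Two-point symmetrization preserves extremal sets. -/
lemma twoPoint (hX : IsIsodiametric D X) (w : EuclideanSpace ℝ (Fin (n + 1))) :
    IsIsodiametric D (twoPoint w X) where
  isClosed := isClosed_twoPoint w hX.isClosed
  nonempty := nonempty_twoPoint w hX.nonempty
  vol_le z := (hX.vol_le z).trans_eq (vol_twoPoint w hX.isClosed.measurableSet).symm
  geodesicDist_le x hx y hy := by
    have h0 : x ∈ X → y ∈ X → geodesicDist x y ≤ D := fun hx hy ↦ hX.geodesicDist_le x hx y hy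
    have h1 : reflect w x ∈ X → reflect w y ∈ X → geodesicDist x y ≤ D := fun hx hy ↦ by
      simpa using hX.geodesicDist_le _ hx _ hy
    have key : ∀ x y : UnitSphere n, 0 ≤ ⟪w, (x : EuclideanSpace ℝ (Fin (n + 1)))⟫ →
        0 ≤ ⟪w, (y : EuclideanSpace ℝ (Fin (n + 1)))⟫ → x ∈ X → reflect w y ∈ X →
        geodesicDist x y ≤ D := by
      intro x y hx hy hxX hyX
      refine le_trans ?_ (hX.geodesicDist_le x hxX _ hyX)
      simpa using geodesicDist_reflect_le w (x := x) (y := reflect w y)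
        (by rw [inner_reflect]; exact mul_nonpos_of_nonneg_of_nonpos hx (by linarith))
    rcases hx with ⟨hx, hx'⟩ | ⟨hx, hx'⟩
    · exact (twoPoint_subset w X hy).elim (h0 hx) (h1 hx')
    · rcases hy with ⟨hy, hy'⟩ | ⟨hy, hy'⟩
      · exact hx'.elim (h0 · hy) (h1 · hy')
      · rcases hx' with hx' | hx' <;> rcases hy' with hy' | hy'
        · exact h0 hx' hy'
        · exact key x y hx hy hx' hy'
        · rw [geodesicDist_comm]
          exact key y x hy hx hy' hx'
        · exact h1 hx' hy'

/-- The nearest points of two points at the same distance from an extremal set are related by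
the reflection that exchanges the two points. -/
lemma reflect_eq_of_geodesicDist_eq (hX : IsIsodiametric D X) (hn : 1 ≤ n) (hD : 0 < D)
    (ht : 0 < t) (htD : D + t < π) {p₁ p₂ x₁ x₂ : UnitSphere n}
    (hp₁ : ∀ x ∈ X, t ≤ geodesicDist p₁ x) (hp₂ : ∀ x ∈ X, t ≤ geodesicDist p₂ x) (hx₁ : x₁ ∈ X)
    (hx₂ : x₂ ∈ X) (hpx₁ : geodesicDist p₁ x₁ = t) (hpx₂ : geodesicDist p₂ x₂ = t) :
    reflect ((p₂ : EuclideanSpace ℝ (Fin (n + 1))) - (p₁ : EuclideanSpace ℝ (Fin (n + 1)))) x₁ =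
      x₂ := by
  set w : EuclideanSpace ℝ (Fin (n + 1)) :=
    (p₂ : EuclideanSpace ℝ (Fin (n + 1))) - (p₁ : EuclideanSpace ℝ (Fin (n + 1)))
  have hσ : reflect w p₂ = p₁ := reflect_sub_left p₂ p₁
  have hx₁w : 0 ≤ ⟪w, (reflect w x₁ : EuclideanSpace ℝ (Fin (n + 1)))⟫ := by
    rw [inner_sub_nonneg_iff, geodesicDist_comm, geodesicDist_reflect_left, hσ, geodesicDist_comm,
      hpx₁, ← hσ, geodesicDist_reflect_reflect]
    exact hp₂ x₁ hx₁
  -- Both `reflect w x₁` and `x₂` are nearest points to `p₂` in the symmetrized set.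
  refine (hX.twoPoint w).eq_of_geodesicDist_eq hn hD ht htD (p := p₂) ?_
    (Or.inr ⟨hx₁w, Or.inr (by simpa using hx₁)⟩)
    (Or.inr ⟨inner_sub_nonneg_iff.mpr (by rw [hpx₂]; exact hp₁ x₂ hx₂), Or.inl hx₂⟩) ?_ hpx₂
  · intro y hy
    rcases twoPoint_subset w X hy with h | h
    · exact hp₂ y h
    · rw [← geodesicDist_reflect_reflect w, hσ]
      exact hp₁ _ h
  · rw [← geodesicDist_reflect_left, hσ, hpx₁]

end IsIsodiametric

/-- Three distinct points of the unit sphere are affinely independent. -/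
lemma eq_of_smul_add_smul_eq {p q r : UnitSphere n} (hpq : p ≠ q) (hpr : p ≠ r) (hqr : q ≠ r)
    {α β : ℝ}
    (h : α • ((q : EuclideanSpace ℝ (Fin (n + 1))) - (p : EuclideanSpace ℝ (Fin (n + 1)))) =
      β • ((r : EuclideanSpace ℝ (Fin (n + 1))) - (p : EuclideanSpace ℝ (Fin (n + 1))))) :
    β = 0 := by
  by_contra hβ
  set v := (q : EuclideanSpace ℝ (Fin (n + 1))) - (p : EuclideanSpace ℝ (Fin (n + 1)))
  set w := (r : EuclideanSpace ℝ (Fin (n + 1))) - (p : EuclideanSpace ℝ (Fin (n + 1)))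
  -- A line through `p` meets the sphere at most twice: on `p + λ v` this equation becomes `λ (λ -
  -- 1) = 0`.
  have hsphere : ∀ y : UnitSphere n, 2 * ⟪(p : EuclideanSpace ℝ (Fin (n + 1))),
      (y : EuclideanSpace ℝ (Fin (n + 1))) - (p : EuclideanSpace ℝ (Fin (n + 1)))⟫ +
      ‖(y : EuclideanSpace ℝ (Fin (n + 1))) - (p : EuclideanSpace ℝ (Fin (n + 1)))‖ ^ 2 = 0 := by
    intro y
    rw [norm_sub_sq_real, norm_eq_of_mem_sphere, norm_eq_of_mem_sphere, inner_sub_right,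
      inner_self_coe, real_inner_comm]
    ring
  have hv0 : ‖v‖ ^ 2 ≠ 0 := by
    simpa [v, sub_eq_zero, Subtype.coe_inj] using hpq.symm
  have hw : w = (α / β) • v := by
    rw [div_eq_inv_mul, mul_smul, h, inv_smul_smul₀ hβ]
  have h1 := hsphere q
  have h2 := hsphere r
  change 2 * ⟪(p : EuclideanSpace ℝ (Fin (n + 1))), v⟫ + ‖v‖ ^ 2 = 0 at h1
  change 2 * ⟪(p : EuclideanSpace ℝ (Fin (n + 1))), w⟫ + ‖w‖ ^ 2 = 0 at h2
  rw [hw, real_inner_smul_right, norm_smul, mul_pow, norm_eq_abs, sq_abs] at h2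
  have h3 : (α / β) * (α / β - 1) * ‖v‖ ^ 2 = 0 := by linear_combination h2 - (α / β) * h1
  rcases mul_eq_zero.mp ((mul_eq_zero.mp h3).resolve_right hv0) with h4 | h4
  · rw [h4, zero_smul, sub_eq_zero] at hw
    exact hpr (Subtype.ext hw.symm)
  · rw [sub_eq_zero.mp h4, one_smul] at hw
    exact hqr (Subtype.ext (sub_left_injective hw.symm))

namespace IsIsodiametric

variable {D t : ℝ} {X : Set (UnitSphere n)}

/-- The points at a given small distance from an extremal set lie in a hyperplane. -/
lemma exists_inner_eq_of_geodesicDist_eq (hX : IsIsodiametric D X) (hn : 1 ≤ n) (hD : 0 < D)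
    (ht : 0 < t) (htD : D + t < π) :
    ∃ (a : EuclideanSpace ℝ (Fin (n + 1))) (c : ℝ), a ≠ 0 ∧ ∀ p : UnitSphere n,
      (∀ x ∈ X, t ≤ geodesicDist p x) → (∃ x ∈ X, geodesicDist p x = t) →
        ⟪a, (p : EuclideanSpace ℝ (Fin (n + 1)))⟫ = c := by
  set S : Set (UnitSphere n) :=
    {p | (∀ x ∈ X, t ≤ geodesicDist p x) ∧ ∃ x ∈ X, geodesicDist p x = t} with hS
  suffices ∃ (a : EuclideanSpace ℝ (Fin (n + 1))) (c : ℝ), a ≠ 0 ∧ ∀ p ∈ S,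
      ⟪a, (p : EuclideanSpace ℝ (Fin (n + 1)))⟫ = c by
    obtain ⟨a, c, ha, h⟩ := this
    exact ⟨a, c, ha, fun p h1 h2 ↦ h p ⟨h1, h2⟩⟩
  rcases S.subsingleton_or_nontrivial with hsub | ⟨p₁, hp₁, p₂, hp₂, hne⟩
  · rcases S.eq_empty_or_nonempty with h | ⟨p, hp⟩
    · obtain ⟨x, -⟩ := hX.nonempty
      exact ⟨x, 0, ne_zero_of_mem_unit_sphere x, fun p hp ↦ absurd hp (h ▸ notMem_empty p)⟩
    · exact ⟨p, 1, ne_zero_of_mem_unit_sphere p, fun q hq ↦ by rw [hsub hq hp, inner_self_coe]⟩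
  have hfoot : ∀ p ∈ S, ∃ x ∈ X, geodesicDist p x = t := fun p hp ↦ hp.2
  choose! f hfX hft using hfoot
  have hslope : ∀ p ∈ S, ∀ q ∈ S, ∃ l : ℝ,
      (f q : EuclideanSpace ℝ (Fin (n + 1))) - (f p : EuclideanSpace ℝ (Fin (n + 1))) =
        l • ((q : EuclideanSpace ℝ (Fin (n + 1))) - (p : EuclideanSpace ℝ (Fin (n + 1)))) := by
    intro p hp q hq
    have h := hX.reflect_eq_of_geodesicDist_eq hn hD ht htD hp.1 hq.1 (hfX p hp) (hfX q hq)
      (hft p hp) (hft q hq)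
    rw [← h, coe_reflect_eq_sub]
    exact ⟨_, by rw [sub_sub_cancel_left, ← neg_smul]⟩
  obtain ⟨l, hl⟩ := hslope p₁ hp₁ p₂ hp₂
  have haff : ∀ q ∈ S, (f q : EuclideanSpace ℝ (Fin (n + 1))) -
      (f p₁ : EuclideanSpace ℝ (Fin (n + 1))) =
        l • ((q : EuclideanSpace ℝ (Fin (n + 1))) - (p₁ : EuclideanSpace ℝ (Fin (n + 1)))) := by
    intro q hq
    by_cases h1 : p₁ = q
    · subst h1; simp
    by_cases h2 : p₂ = q
    · subst h2; exact hl
    obtain ⟨m, hm⟩ := hslope p₁ hp₁ q hq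
    obtain ⟨k, hk⟩ := hslope p₂ hp₂ q hq
    -- Adding the displacements along `p₁, p₂, q` gives `(m - k)(q - p₁) = (l - k)(p₂ - p₁)`; affine
    -- independence makes all three slopes equal.
    have hmk : m - k = 0 := by
      refine eq_of_smul_add_smul_eq hne h1 h2 (α := l - k) ?_
      have e : (f q : EuclideanSpace ℝ (Fin (n + 1))) - f p₁ = (f q - f p₂) + (f p₂ - f p₁) := by
        abel
      rw [hm, hk, hl] at e
      rw [sub_smul, sub_smul, e]
      module
    have hlk : l - k = 0 := by
      refine eq_of_smul_add_smul_eq h1 hne (Ne.symm h2) (α := m - k) ?_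
      have e : (f q : EuclideanSpace ℝ (Fin (n + 1))) - f p₁ = (f q - f p₂) + (f p₂ - f p₁) := by
        abel
      rw [hm, hk, hl] at e
      rw [sub_smul, sub_smul, e]
      module
    rw [hm, show m = l by linarith]
  refine ⟨(f p₁ : EuclideanSpace ℝ (Fin (n + 1))) - l • (p₁ : EuclideanSpace ℝ (Fin (n + 1))),
    cos t - l, ?_, ?_⟩
  -- If `f p₁ = l p₁`, then `l = cos t` and `l² = 1`, impossible for `0 < t < π`.
  · intro h0
    have h1 : cos t = l := by
      rw [← hft p₁ hp₁, cos_geodesicDist, sub_eq_zero.mp h0, real_inner_smul_right,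
        inner_self_coe, mul_one]
    have h2 : l ^ 2 = 1 := by
      have := inner_self_coe (f p₁)
      rw [sub_eq_zero.mp h0, real_inner_smul_right, real_inner_smul_left, inner_self_coe] at this
      linarith
    have h3 : 0 < sin t := sin_pos_of_pos_of_lt_pi ht (by linarith)
    have h4 := sin_sq_add_cos_sq t
    rw [h1, h2] at h4
    have : 0 < sin t ^ 2 := by positivity
    linarith
  · intro q hq
    have h1 : (f p₁ : EuclideanSpace ℝ (Fin (n + 1))) - l • (p₁ : EuclideanSpace ℝ (Fin (n + 1))) =
        (f q : EuclideanSpace ℝ (Fin (n + 1))) - l • (q : EuclideanSpace ℝ (Fin (n + 1))) := by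
      have := haff q hq
      rw [smul_sub] at this
      rw [sub_eq_sub_iff_sub_eq_sub, ← neg_sub, this]
      abel
    rw [h1, inner_sub_left, real_inner_smul_left, inner_self_coe, real_inner_comm,
      ← cos_geodesicDist, hft q hq, mul_one]

end IsIsodiametric

/-! ### Sides of a hyperplane -/

/-- An open cap is star-shaped about `z` along great circles. -/
lemma isPreconnected_setOf_lt_inner (hn : 1 ≤ n) (z : UnitSphere n) (c : ℝ) :
    IsPreconnected {p : UnitSphere n |
      c < ⟪(z : EuclideanSpace ℝ (Fin (n + 1))), (p : EuclideanSpace ℝ (Fin (n + 1)))⟫} := by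
  refine isPreconnected_of_forall z fun y hy ↦ ?_
  obtain ⟨u, h, hu⟩ := exists_greatCircle_eq hn z y
  have hy : c < ⟪(z : EuclideanSpace ℝ (Fin (n + 1))), (y : EuclideanSpace ℝ (Fin (n + 1)))⟫ := hy
  rw [← hu, inner_greatCircle] at hy
  refine ⟨greatCircle z u h '' Icc 0 (geodesicDist y z), ?_,
    ⟨0, ⟨le_rfl, geodesicDist_nonneg _ _⟩, greatCircle_zero h⟩,
    ⟨_, ⟨geodesicDist_nonneg _ _, le_rfl⟩, hu⟩,
    isPreconnected_Icc.image _ (continuous_greatCircle h).continuousOn⟩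
  rintro _ ⟨s, hs, rfl⟩
  change c < ⟪(z : EuclideanSpace ℝ (Fin (n + 1))), (greatCircle z u h s : EuclideanSpace ℝ _)⟫
  rw [inner_greatCircle]
  exact hy.trans_le (cos_le_cos_of_nonneg_of_le_pi hs.1 (geodesicDist_le_pi _ _) hs.2)

lemma exists_inner_ne_of_isOpen (hn : 1 ≤ n) {U : Set (UnitSphere n)} (hU : IsOpen U)
    (hne : U.Nonempty) (z : UnitSphere n) (c : ℝ) :
    ∃ p ∈ U, ⟪(z : EuclideanSpace ℝ (Fin (n + 1))), (p : EuclideanSpace ℝ (Fin (n + 1)))⟫ ≠ c := by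
  obtain ⟨p, hp⟩ := hne
  by_cases hpc : ⟪(z : EuclideanSpace ℝ (Fin (n + 1))), (p : EuclideanSpace ℝ (Fin (n + 1)))⟫ = c
  swap
  · exact ⟨p, hp, hpc⟩
  obtain ⟨u, h, hu⟩ := exists_greatCircle_eq hn z p
  have hev : ∀ᶠ s in 𝓝 (geodesicDist p z), greatCircle z u h s ∈ U :=
    (continuous_greatCircle h).continuousAt.eventually_mem (hU.mem_nhds (by rwa [hu]))
  obtain ⟨s, hsU, hs0, hspi, hne⟩ : ∃ s, greatCircle z u h s ∈ U ∧ 0 ≤ s ∧ s ≤ π ∧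
      s ≠ geodesicDist p z := by
    rcases (geodesicDist_nonneg p z).eq_or_lt with h0 | h0
    · obtain ⟨s, h1, h2, h3⟩ := ((hev.filter_mono nhdsWithin_le_nhds).and
        (Ioo_mem_nhdsGT (show geodesicDist p z < π by rw [← h0]; exact pi_pos))).exists
      exact ⟨s, h1, h0.le.trans h2.le, h3.le, h2.ne'⟩
    · obtain ⟨s, h1, h2, h3⟩ := ((hev.filter_mono nhdsWithin_le_nhds).and
        (Ioo_mem_nhdsLT h0)).exists
      exact ⟨s, h1, h2.le, h3.le.trans (geodesicDist_le_pi _ _), h3.ne⟩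
  refine ⟨_, hsU, fun hc ↦ hne ?_⟩
  rw [← hpc, inner_greatCircle, ← hu, inner_greatCircle] at hc
  exact injOn_cos ⟨hs0, hspi⟩ ⟨geodesicDist_nonneg _ _, geodesicDist_le_pi _ _⟩ hc

lemma isClosed_geodesicCthickening {X : Set (UnitSphere n)} (hX : IsClosed X) (t : ℝ) :
    IsClosed (geodesicCthickening t X) := by
  have hC : IsClosed {q : UnitSphere n × UnitSphere n | q.2 ∈ X ∧ geodesicDist q.1 q.2 ≤ t} :=
    (hX.preimage continuous_snd).inter (isClosed_le continuous_geodesicDist continuous_const)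
  convert (hC.isCompact.image continuous_fst).isClosed
  ext p
  simp [geodesicCthickening]

namespace IsIsodiametric

variable {D t : ℝ} {X : Set (UnitSphere n)}

/-- If `x` is at angle `φ > D / 2` from `z`, moving outward from `x` by `t` shows that the cap
reaches angle `φ + t`. The point at angle `D + t - φ < φ + t` on the opposite side is then within
`t` of some `y ∈ X`, yet at distance `D + t` from `x`, so `d(x, y) > D`. -/
lemma subset_geodesicBall (hX : IsIsodiametric D X) (hn : 1 ≤ n) (hD : 0 < D)
    (ht : 0 < t) (htD : D + t < π) {z : UnitSphere n} {c : ℝ}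
    (hnear : ∀ p : UnitSphere n, c < ⟪(z : EuclideanSpace ℝ (Fin (n + 1))),
      (p : EuclideanSpace ℝ (Fin (n + 1)))⟫ → p ∈ geodesicThickening t X)
    (hfar : ∀ p : UnitSphere n, ⟪(z : EuclideanSpace ℝ (Fin (n + 1))),
      (p : EuclideanSpace ℝ (Fin (n + 1)))⟫ < c → p ∉ geodesicCthickening t X) :
    X ⊆ geodesicBall z (D / 2) := by
  intro x hx
  change geodesicDist x z ≤ D / 2
  by_contra! hlt
  obtain ⟨u, h, hu⟩ := exists_greatCircle_eq hn z x
  set φ := geodesicDist x z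
  have hφ : φ ≤ π := geodesicDist_le_pi x z
  -- Truncating here at the antipode of `z`, and `ψ` below at `z`, keeps the angles in `[0, π]`,
  -- where `cos` is monotone.
  set s := min t (π - φ) with hs
  have hs0 : 0 ≤ s := le_min ht.le (by linarith)
  have hst : s ≤ t := min_le_left _ _
  have hsφ : φ + s ≤ π := by linarith [min_le_right t (π - φ)]
  have hc : c ≤ cos (φ + s) := by
    rw [← inner_greatCircle h]
    refine not_lt.mp fun hlt' ↦ hfar _ hlt' ⟨x, hx, ?_⟩
    have := geodesicDist_greatCircle h (s := φ + s) (t := φ)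
      (by rw [add_sub_cancel_left, abs_of_nonneg hs0]; linarith)
    rw [hu, add_sub_cancel_left, abs_of_nonneg hs0] at this
    rwa [this]
  set ψ := max 0 (D + t - φ)
  have hψ0 : 0 ≤ ψ := le_max_left _ _
  have hψ1 : D + t - φ ≤ ψ := le_max_right _ _
  have hψ2 : φ + ψ ≤ π := by
    rcases max_cases 0 (D + t - φ) with h | h <;> linarith
  have hψ3 : ψ < φ + s := by
    rcases max_cases 0 (D + t - φ) with h | h <;> rcases min_cases t (π - φ) with h' | h' <;>
      linarith
  have hmem : c < ⟪(z : EuclideanSpace ℝ (Fin (n + 1))),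
      (greatCircle z u h (-ψ) : EuclideanSpace ℝ (Fin (n + 1)))⟫ := by
    rw [inner_greatCircle, cos_neg]
    exact hc.trans_lt (cos_lt_cos_of_nonneg_of_le_pi hψ0 hsφ hψ3)
  obtain ⟨y, hy, hyt⟩ := hnear _ hmem
  have habs : |φ - -ψ| = φ + ψ := by rw [sub_neg_eq_add, abs_of_nonneg (by linarith)]
  have hdist := geodesicDist_greatCircle h (s := φ) (t := -ψ) (by rw [habs]; exact hψ2)
  rw [hu, habs] at hdist
  have := geodesicDist_triangle x y (greatCircle z u h (-ψ))
  rw [geodesicDist_comm y] at this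
  linarith [hX.geodesicDist_le x hx y hy]

/-- Extremal sets are balls. -/
lemma exists_eq_geodesicBall (hX : IsIsodiametric D X) (hn : 1 ≤ n) (hD : 0 < D) (hDpi : D < π) :
    ∃ z, X = geodesicBall z (D / 2) := by
  -- Any `t` in `(0, π - D)` would do.
  set t := (π - D) / 2
  have ht : 0 < t := by simp only [t]; linarith
  have htD : D + t < π := by simp only [t]; linarith
  suffices ∃ z, X ⊆ geodesicBall z (D / 2) by
    obtain ⟨z, hz⟩ := this
    refine ⟨z, hz.antisymm ?_⟩
    by_contra hnot
    obtain ⟨b₀, hb₀, hb₀X⟩ := not_subset.mp hnot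
    obtain ⟨b, hb, hbX⟩ := exists_geodesicDist_lt_notMem hn (half_pos hD) hX.isClosed hb₀ hb₀X
    have hgap : 0 < vol n (geodesicBall z (D / 2) \ X) := by
      refine ((IsOpen.inter (isOpen_setOf_geodesicDist_lt z (D / 2))
        hX.isClosed.isOpen_compl).measure_pos _ ⟨b, hb, hbX⟩).trans_le
        (measure_mono fun x hx ↦ ⟨?_, hx.2⟩)
      have hxr : geodesicDist x z < D / 2 := hx.1
      exact hxr.le
    have h := hX.vol_le z
    rw [← measure_inter_add_sdiff _ hX.isClosed.measurableSet, inter_eq_self_of_subset_right hz]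
      at h
    exact hgap.not_ge ((ENNReal.add_le_add_iff_left (measure_ne_top _ X)).mp
      (h.trans_eq (add_zero _).symm))
  obtain ⟨a, c, ha, hac⟩ := hX.exists_inner_eq_of_geodesicDist_eq hn hD ht htD
  obtain ⟨z, κ, hz⟩ : ∃ (z : UnitSphere n) (κ : ℝ), ∀ p : UnitSphere n,
      (∀ x ∈ X, t ≤ geodesicDist p x) → (∃ x ∈ X, geodesicDist p x = t) →
        ⟪(z : EuclideanSpace ℝ (Fin (n + 1))), (p : EuclideanSpace ℝ (Fin (n + 1)))⟫ = κ := by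
    refine ⟨⟨‖a‖⁻¹ • a, ?_⟩, ‖a‖⁻¹ * c, fun p h1 h2 ↦ ?_⟩
    · rw [mem_sphere_zero_iff_norm, norm_smul, norm_inv, norm_norm,
        inv_mul_cancel₀ (norm_ne_zero_iff.mpr ha)]
    · rw [real_inner_smul_left, hac p h1 h2]
  set U := geodesicThickening t X
  set Q := (geodesicCthickening t X)ᶜ
  have hU : IsOpen U := isOpen_geodesicThickening t X
  have hQ : IsOpen Q := (isClosed_geodesicCthickening hX.isClosed t).isOpen_compl
  have hUQ : Disjoint U Q := disjoint_left.mpr fun p ⟨y, hy, hpy⟩ hpQ ↦ hpQ ⟨y, hy, hpy.le⟩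
  have hcover : ∀ p : UnitSphere n, ⟪(z : EuclideanSpace ℝ (Fin (n + 1))),
      (p : EuclideanSpace ℝ (Fin (n + 1)))⟫ ≠ κ → p ∈ U ∪ Q := by
    intro p hp
    by_contra hnot
    rw [mem_union, not_or] at hnot
    obtain ⟨hpU, hpQ⟩ := hnot
    obtain ⟨x, hx, hpx⟩ := not_not.mp hpQ
    have hle : ∀ y ∈ X, t ≤ geodesicDist p y := fun y hy ↦ not_lt.mp fun h ↦ hpU ⟨y, hy, h⟩
    exact hp (hz p hle ⟨x, hx, hpx.antisymm (hle x hx)⟩)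
  have hpos := (isPreconnected_setOf_lt_inner hn z κ).subset_or_subset hU hQ hUQ
    fun p hp ↦ hcover p (ne_of_gt hp)
  have hneg := (isPreconnected_setOf_lt_inner hn (-z) (-κ)).subset_or_subset hU hQ hUQ
    fun p hp ↦ hcover p (by
      have hp : -κ < ⟪-(z : EuclideanSpace ℝ (Fin (n + 1))),
        (p : EuclideanSpace ℝ (Fin (n + 1)))⟫ := hp
      rw [inner_neg_left, neg_lt_neg_iff] at hp
      exact hp.ne)
  have hmem_neg : ∀ p : UnitSphere n, ⟪(z : EuclideanSpace ℝ (Fin (n + 1))),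
      (p : EuclideanSpace ℝ (Fin (n + 1)))⟫ < κ → p ∈ {p : UnitSphere n |
      -κ < ⟪((-z : UnitSphere n) : EuclideanSpace ℝ (Fin (n + 1))),
        (p : EuclideanSpace ℝ (Fin (n + 1)))⟫} := by
    intro p hp
    change -κ < ⟪-(z : EuclideanSpace ℝ (Fin (n + 1))), (p : EuclideanSpace ℝ (Fin (n + 1)))⟫
    rwa [inner_neg_left, neg_lt_neg_iff]
  obtain ⟨x₀, hx₀⟩ := hX.nonempty
  obtain ⟨p, hpU, hpκ⟩ := exists_inner_ne_of_isOpen hn hU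
    ⟨x₀, x₀, hx₀, by rwa [geodesicDist_self]⟩ z κ
  have hQne : Q.Nonempty := by
    refine ⟨-x₀, ?_⟩
    rintro ⟨y, hy, hxy⟩
    rw [geodesicDist_comm, geodesicDist_neg_right] at hxy
    linarith [hX.geodesicDist_le y hy x₀ hx₀]
  obtain ⟨q, hqQ, hqκ⟩ := exists_inner_ne_of_isOpen hn hQ hQne z κ
  -- Both `U` and `Q` have points off the hyperplane, so the two caps cannot lie in the same one;
  -- the mixed cases differ by `z ↦ -z`.
  rcases hpos with hpos | hpos <;> rcases hneg with hneg | hneg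
  · exfalso
    rcases hqκ.lt_or_gt with h | h
    · exact disjoint_left.mp hUQ (hneg (hmem_neg q h)) hqQ
    · exact disjoint_left.mp hUQ (hpos h) hqQ
  · exact ⟨z, hX.subset_geodesicBall hn hD ht htD (fun p hp ↦ hpos hp)
      fun p hp ↦ hneg (hmem_neg p hp)⟩
  · refine ⟨-z, hX.subset_geodesicBall hn hD ht htD (c := -κ) (fun p hp ↦ hneg hp)
      fun p hp ↦ hpos ?_⟩
    change ⟪-(z : EuclideanSpace ℝ (Fin (n + 1))), (p : EuclideanSpace ℝ (Fin (n + 1)))⟫ < -κ at hp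
    rwa [inner_neg_left, neg_lt_neg_iff] at hp
  · exfalso
    rcases hpκ.lt_or_gt with h | h
    · exact disjoint_left.mp hUQ hpU (hneg (hmem_neg p h))
    · exact disjoint_left.mp hUQ hpU (hpos h)

end IsIsodiametric

/-! ### Passage to closures and the main theorem -/

lemma geodesicDist_le_of_geodesicDiam_le {X : Set (UnitSphere n)} {D : ℝ}
    (h : geodesicDiam X ≤ D) {x y : UnitSphere n} (hx : x ∈ X) (hy : y ∈ X) :
    geodesicDist x y ≤ D := by
  refine le_trans (le_csSup ⟨π, ?_⟩ (mem_image2_of_mem hx hy)) h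
  rintro _ ⟨x, -, y, -, rfl⟩
  exact geodesicDist_le_pi x y

lemma geodesicDist_le_of_mem_closure {X : Set (UnitSphere n)} {D : ℝ}
    (h : geodesicDiam X ≤ D) {x y : UnitSphere n} (hx : x ∈ closure X) (hy : y ∈ closure X) :
    geodesicDist x y ≤ D := by
  have h1 : ∀ y ∈ X, closure X ⊆ geodesicBall y D := fun y hy ↦
    closure_minimal (fun x hx ↦ geodesicDist_le_of_geodesicDiam_le h hx hy)
      (isClosed_geodesicBall y D)
  have h2 : closure X ⊆ geodesicBall x D :=
    closure_minimal (fun y hy ↦ (geodesicDist_comm y x).trans_le (h1 y hy hx))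
      (isClosed_geodesicBall x D)
  exact (geodesicDist_comm x y).trans_le (h2 hy)

lemma vol_geodesicBall_eq (z z' : UnitSphere n) (r : ℝ) :
    vol n (geodesicBall z r) = vol n (geodesicBall z' r) :=
  vol_setOf_geodesicDist_mem_eq z z' (measurableSet_Iic (a := r))

lemma vol_geodesicBall_pos (z : UnitSphere n) {r : ℝ} (hr : 0 < r) :
    0 < vol n (geodesicBall z r) := by
  refine ((isOpen_setOf_geodesicDist_lt z r).measure_pos _ ⟨z, ?_⟩).trans_le
    (measure_mono fun x (hx : geodesicDist x z < r) ↦ hx.le)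
  rwa [mem_ofPred_eq, geodesicDist_self]

end UnitSphere

theorem theorem1p2 (n : ℕ) (hn : 1 ≤ n) (D : ℝ) (hD0 : 0 < D) (hDpi : D < Real.pi)
    (z₀ : UnitSphere n) (X : Set (UnitSphere n))
    (hX : NullMeasurableSet X (UnitSphere.vol n))
    (hdiam : UnitSphere.geodesicDiam X ≤ D) :
    UnitSphere.vol n X ≤ UnitSphere.vol n (UnitSphere.geodesicBall z₀ (D / 2)) ∧
    (UnitSphere.vol n X = UnitSphere.vol n (UnitSphere.geodesicBall z₀ (D / 2)) ↔
      (∃ z : UnitSphere n, closure X = UnitSphere.geodesicBall z (D / 2)) ∧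
        UnitSphere.vol n (closure X \ X) = 0) := by
  have hsplit : UnitSphere.vol n (closure X) =
      UnitSphere.vol n X + UnitSphere.vol n (closure X \ X) := by
    rw [← measure_inter_add_sdiff₀ (closure X) hX,
      Set.inter_eq_self_of_subset_right subset_closure]
  -- The reverse inequality alone makes the closure a ball; this gives both the bound and the
  -- equality case.
  have key : UnitSphere.vol n (UnitSphere.geodesicBall z₀ (D / 2)) ≤ UnitSphere.vol n X →
      ∃ z : UnitSphere n, closure X = UnitSphere.geodesicBall z (D / 2) := by
    intro h
    have hne : X.Nonempty := by
      rw [Set.nonempty_iff_ne_empty]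
      rintro rfl
      rw [measure_empty] at h
      exact (UnitSphere.vol_geodesicBall_pos z₀ (half_pos hD0)).not_ge h
    refine UnitSphere.IsIsodiametric.exists_eq_geodesicBall ⟨isClosed_closure, hne.closure,
      fun x hx y hy ↦ UnitSphere.geodesicDist_le_of_mem_closure hdiam hx hy, fun z ↦ ?_⟩ hn hD0 hDpi
    rw [UnitSphere.vol_geodesicBall_eq z z₀]
    exact h.trans (measure_mono subset_closure)
  refine ⟨?_, fun h ↦ ?_, ?_⟩
  · rcases le_total (UnitSphere.vol n X)
      (UnitSphere.vol n (UnitSphere.geodesicBall z₀ (D / 2))) with h | h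
    · exact h
    · obtain ⟨z, hz⟩ := key h
      rw [UnitSphere.vol_geodesicBall_eq z₀ z, ← hz]
      exact measure_mono subset_closure
  · obtain ⟨z, hz⟩ := key h.ge
    refine ⟨⟨z, hz⟩, ?_⟩
    rw [hz, UnitSphere.vol_geodesicBall_eq z z₀, ← h, ← hz] at hsplit
    have h0 : UnitSphere.vol n X + 0 =
        UnitSphere.vol n X + UnitSphere.vol n (closure X \ X) := by rw [add_zero]; exact hsplit
    exact ((ENNReal.add_right_inj (measure_ne_top _ _)).mp h0).symm
  · rintro ⟨⟨z, hz⟩, h0⟩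
    rw [UnitSphere.vol_geodesicBall_eq z₀ z, ← hz, hsplit, h0, add_zero]
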